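/- Let $\theta_0\in\mathbb R$, $r_*>0$, and let $r_1,r_2:[\theta_0,\infty)\to(0,\infty)$ be continuous with $r_2(\theta+2\pi)<r_1(\theta)<r_2(\theta)$ for all $\theta\ge\theta_0$ and $\lim_{\theta\to\infty}r_1(\theta)=\lim_{\theta\to\infty}r_2(\theta)=r_*$. With $X(r,\theta)=(r\cos\theta,r\sin\theta)$ put $$U=\{X(r,\theta):\theta>\theta_0,\ r_1(\theta)<r<r_2(\theta)\},\qquad \widetilde U=\{X(r,\theta):\theta\ge\theta_0,\ r_1(\theta)\le r\le r_2(\theta)\},$$ $$\mathcal S_\theta=\{X(r,\theta):r_1(\theta)\le r\le r_2(\theta)\},\qquad \gamma=\{X(r_i(\theta),\theta):\theta\ge\theta_0,\ i=1,2\}.$$ Let $Lu=-\sum_{i,j=1}^2a_{ij}\,\partial_i\partial_ju+b\cdot\nabla u$, where $b:U\to\mathbb R^2$ and $A=(a_{ij}):U\to\mathbb R^{2\times2}$ is symmetric and, for some constants $c_0,M_1>0$, satisfies $\xi^{\rm T}A(x)\xi\ge c_0|\xi|^2$ and $\operatorname{Tr}A(x)\le M_1$ for all $x\in U$, $\xi\in\mathbb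 R^2$. Assume that there are $\bar\Theta\ge\theta_0$, a nondecreasing function $m:[\bar\Theta,\infty)\to[0,\infty)$ and $\kappa\in(0,1)$ such that $b$ is bounded on $\{X(r,\theta)\in U:\theta_0<\theta\le\bar\Theta,\ r_1(\theta)<r<r_2(\theta)\}$, $|b(x)|\le m(\theta)$ for all $\theta\ge\bar\Theta$ and $x\in U\cap\mathcal S_\theta$, $\lim_{\theta\to\infty}m(\theta)=\infty$, and $\int_{\bar\Theta}^\infty\kappa^{m(\theta)}\,d\theta=\infty$. Then there exist numbers $\Theta_0\ge\bar\Theta$ and $\bar\nu>0$, independent of $u$, for which both of the following hold. (1) Let $u\in C^2(U)\cap C(\widetilde U)$ satisfy $Lu\le0$ in $U$ and $u\le0$ on $\gamma$, and put $\mathcal M(\theta)=\max_{\mathcal S_\theta}u^+$, where $u^+=\max\{0,u\}$. Then one of the following two possibilities occurs: (i) for all $\theta\ge\theta_0$, $$\mathcal M(\theta)\le\mathcal M(\theta_0)\,\min\Big\{1,\exp\Big(-\bar\nu\int_{\Theta_0}^\theta\kappa^{m(\zeta)}\,d\zeta\Big)\Big\}$$ (the minimum being read as $1$ for $\theta<\Theta_0$),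 and $\lim_{\theta\to\infty}\mathcal M(\theta)=0$; (ii) there is $C>0$, depending on $u$, such that for all sufficiently large $\theta$ $$\mathcal M(\theta)\ge C\exp\Big(\bar\nu\int_{\bar\Theta}^\theta\kappa^{m(\zeta)}\,d\zeta\Big),$$ and $\lim_{\theta\to\infty}\mathcal M(\theta)=\infty$. (2) Let $u\in C^2(U)\cap C(\widetilde U)$ satisfy $Lu=0$ in $U$ and $u=0$ on $\gamma$. Then the same dichotomy, (i) or (ii), holds with $\mathcal M(\theta)=\max_{\mathcal S_\theta}|u|$. -/

import Mathlib

open Set Filter Topology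

noncomputable section

namespace WindingDomain

/-- The Euclidean plane. -/
abbrev Plane : Type := EuclideanSpace ℝ (Fin 2)

/-- Polar coordinates `X(r, θ) = (r cos θ, r sin θ)`. -/
def polar (r θ : ℝ) : Plane := !₂[r * Real.cos θ, r * Real.sin θ]

/-- The standing geometric assumptions on the two radii: they are continuous and positive on
`[θ₀, ∞)`, the spiral strip between them does not meet itself, and both converge to `rs > 0`. -/
structure IsSpiral (θ₀ rs : ℝ) (r₁ r₂ : ℝ → ℝ) : Prop where
  continuousOn_left : ContinuousOn r₁ (Ici θ₀)
  continuousOn_right : ContinuousOn r₂ (Ici θ₀)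
  pos_left : ∀ θ, θ₀ ≤ θ → 0 < r₁ θ
  pos_right : ∀ θ, θ₀ ≤ θ → 0 < r₂ θ
  nested : ∀ θ, θ₀ ≤ θ → r₂ (θ + 2 * Real.pi) < r₁ θ ∧ r₁ θ < r₂ θ
  limit_pos : 0 < rs
  tendsto_left : Tendsto r₁ atTop (𝓝 rs)
  tendsto_right : Tendsto r₂ atTop (𝓝 rs)

/-- The open part `U_I = {X(r, θ) : θ ∈ I, r₁(θ) < r < r₂(θ)}` of the strip over a set of angles. -/
def openPart (r₁ r₂ : ℝ → ℝ) (I : Set ℝ) : Set Plane :=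
  {x | ∃ θ ∈ I, ∃ r, r₁ θ < r ∧ r < r₂ θ ∧ x = polar r θ}

/-- The closed part `{X(r, θ) : θ ∈ I, r₁(θ) ≤ r ≤ r₂(θ)}` of the strip over a set of angles. -/
def closedPart (r₁ r₂ : ℝ → ℝ) (I : Set ℝ) : Set Plane :=
  {x | ∃ θ ∈ I, ∃ r, r₁ θ ≤ r ∧ r ≤ r₂ θ ∧ x = polar r θ}

/-- The domain `U`. -/
def U (θ₀ : ℝ) (r₁ r₂ : ℝ → ℝ) : Set Plane := openPart r₁ r₂ (Ioi θ₀)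

/-- The set `Ũ`, that is `U` with its two lateral curves and its initial cross-section; the limit
circle is not part of it. -/
def UTilde (θ₀ : ℝ) (r₁ r₂ : ℝ → ℝ) : Set Plane := closedPart r₁ r₂ (Ici θ₀)

/-- The cross-section `S_θ`. -/
def crossSection (r₁ r₂ : ℝ → ℝ) (θ : ℝ) : Set Plane := closedPart r₁ r₂ {θ}

/-- The lateral boundary `γ = γ₁ ∪ γ₂`. -/
def lateral (θ₀ : ℝ) (r₁ r₂ : ℝ → ℝ) : Set Plane :=
  {x | ∃ θ, θ₀ ≤ θ ∧ (x = polar (r₁ θ) θ ∨ x = polar (r₂ θ) θ)}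

/-- The partial derivative `∂u/∂xᵢ`. -/
def partialDeriv (i : Fin 2) (u : Plane → ℝ) (x : Plane) : ℝ :=
  fderiv ℝ u x (EuclideanSpace.single i 1)

/-- The operator `Lu = - ∑ aᵢⱼ ∂²u/∂xᵢ∂xⱼ + b · ∇u`. -/
def ellipticOp (A : Plane → Matrix (Fin 2) (Fin 2) ℝ) (b : Plane → Plane)
    (u : Plane → ℝ) (x : Plane) : ℝ :=
  -(∑ i, ∑ j, A x i j * partialDeriv i (partialDeriv j u) x) + ∑ i, b x i * partialDeriv i u x

/-- `A` is symmetric on `Ω`, uniformly elliptic there, and has bounded trace there. -/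
def UniformlyElliptic (A : Plane → Matrix (Fin 2) (Fin 2) ℝ) (Ω : Set Plane) : Prop :=
  (∀ x ∈ Ω, (A x).IsSymm) ∧
  (∃ c₀ : ℝ, 0 < c₀ ∧ ∀ x ∈ Ω, ∀ ξ : Plane, c₀ * ‖ξ‖ ^ 2 ≤ ∑ i, ∑ j, ξ i * A x i j * ξ j) ∧
  (∃ M₁ : ℝ, 0 < M₁ ∧ ∀ x ∈ Ω, (A x).trace ≤ M₁)

/-- The assumption on the possibly unbounded drift. Only the values of `m` on `[Θbar, ∞)` and of
`b` on `U` matter. -/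
structure DriftBound (θ₀ : ℝ) (r₁ r₂ : ℝ → ℝ) (b : Plane → Plane)
    (Θbar κ : ℝ) (m : ℝ → ℝ) : Prop where
  le_start : θ₀ ≤ Θbar
  monotone : MonotoneOn m (Ici Θbar)
  nonneg : ∀ θ, Θbar ≤ θ → 0 ≤ m θ
  bounded_initial : ∃ B : ℝ, ∀ x ∈ U θ₀ r₁ r₂ ∩ openPart r₁ r₂ (Icc θ₀ Θbar), ‖b x‖ ≤ B
  bound : ∀ θ, Θbar ≤ θ → ∀ x ∈ U θ₀ r₁ r₂ ∩ crossSection r₁ r₂ θ, ‖b x‖ ≤ m θ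
  tendsto : Tendsto m atTop atTop
  kappa_pos : 0 < κ
  kappa_lt_one : κ < 1
  divergent : Tendsto (fun T : ℝ => ∫ ζ in Θbar..T, κ ^ m ζ) atTop atTop

/-- The class `C²(U) ∩ C(Ũ)`. -/
def Admissible (θ₀ : ℝ) (r₁ r₂ : ℝ → ℝ) (u : Plane → ℝ) : Prop :=
  ContDiffOn ℝ 2 u (U θ₀ r₁ r₂) ∧ ContinuousOn u (UTilde θ₀ r₁ r₂)

/-- The maximum of `f` over the cross-section `S_θ` (a nonempty compact set, so the supremum of a
function that is continuous on it is attained). -/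
def sectionMax (r₁ r₂ : ℝ → ℝ) (f : Plane → ℝ) (θ : ℝ) : ℝ :=
  sSup (f '' crossSection r₁ r₂ θ)

/-- The decaying alternative for a function `M` of the angle. For `θ < Θ₀` the exponential is at
least one, whatever `m` is below its domain, and the minimum equals one. -/
def Decays (θ₀ Θ₀ ν κ : ℝ) (m M : ℝ → ℝ) : Prop :=
  (∀ θ, θ₀ ≤ θ → M θ ≤ M θ₀ * min 1 (Real.exp (-ν * ∫ ζ in Θ₀..θ, κ ^ m ζ))) ∧
  Tendsto M atTop (𝓝 0)

/-- The growing alternative for a function `M` of the angle. -/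
def Grows (Θbar ν κ : ℝ) (m M : ℝ → ℝ) : Prop :=
  (∃ C : ℝ, 0 < C ∧ ∃ T : ℝ, ∀ θ, T ≤ θ →
    C * Real.exp (ν * ∫ ζ in Θbar..θ, κ ^ m ζ) ≤ M θ) ∧
  Tendsto M atTop atTop

end WindingDomain

end

namespace WindingDomain

/-! The engine is a contraction over a half-turn. Suppose the drift is at most `μ` there and the
strip lies within `ε` of the limit circle. With `e` the unit vector at the middle angle, `c exp(α⟨e,
x⟩)` is a strict subsolution as soon as `α c₀ > μ`; take `α = 2μ / c₀`. At the two ends `⟨e, x⟩ =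
0`, so the barrier is only `c`; on the lateral curves it is at most `N`, where `u ≤ 0`; at the
middle it is at least `N exp(-2αε)`. The maximum principle for the sum bounds `u` at the middle by
`N + c - N exp(-2αε)`, hence by `(1 - κ ^ μ / 2) N` once `ε` is small and `μ` large
(`IsSpiral.le_mul_of_le_ends`).

The rest is one-dimensional. By the weak maximum principle (`IsSpiral.le_of_le_ends`), `M(θ) ≤ max
(M a) (M b)` for `a ≤ θ ≤ b`, so `M` is either nonincreasing throughout or nondecreasing from some
angle on. Iterating the contraction forwards or backwards multiplies factors `1 - κ ^ m / 2 ≤ exp(-κ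
^ m / 2)`; monotonicity of `m` compares the sum of exponents with the integral (`decays_or_grows`).
-/

/-! ### Polar coordinates and topology of the strip -/

@[simp] theorem polar_zero (r θ : ℝ) : polar r θ 0 = r * Real.cos θ := rfl

@[simp] theorem polar_one (r θ : ℝ) : polar r θ 1 = r * Real.sin θ := rfl

theorem continuous_polar : Continuous fun p : ℝ × ℝ => polar p.1 p.2 := by
  unfold polar
  refine (PiLp.continuous_toLp 2 _).comp (continuous_pi fun i => ?_)
  fin_cases i <;> simp <;> fun_prop

theorem inner_polar (φ r θ : ℝ) : inner ℝ (polar 1 φ) (polar r θ) = r * Real.cos (θ - φ) := by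
  simp [PiLp.inner_apply, Fin.sum_univ_two, Real.cos_sub]
  ring

theorem norm_polar_one (φ : ℝ) : ‖polar 1 φ‖ = 1 := by
  simp [EuclideanSpace.norm_eq, Fin.sum_univ_two]

/-- Near `polar r θ` every point has polar coordinates close to `(r, θ)`. -/
theorem eventually_exists_polar {r θ : ℝ} (hr : 0 < r) {P : ℝ × ℝ → Prop}
    (hP : ∀ᶠ p in 𝓝 (r, θ), P p) :
    ∀ᶠ x in 𝓝 (polar r θ), ∃ s φ, P (s, φ) ∧ x = polar s φ := by
  -- Rotation by `-θ` carries the point to the positive real axis, where `Complex.arg` is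
  -- continuous.
  let z : Plane → ℂ := fun x => (x 0 + x 1 * Complex.I) * Complex.exp (-θ * Complex.I)
  have hz : Continuous z := by fun_prop
  have hz0 : z (polar r θ) = r := by
    have h : ((polar r θ 0 : ℝ) : ℂ) + (polar r θ 1 : ℝ) * Complex.I
        = r * Complex.exp (θ * Complex.I) := by
      rw [Complex.exp_mul_I]; simp; ring
    simp only [z]
    rw [h, mul_assoc, ← Complex.exp_add]; simp
  have hx : ∀ x, x = polar ‖z x‖ (θ + (z x).arg) := by
    intro x
    have h : ((x 0 : ℝ) : ℂ) + (x 1 : ℝ) * Complex.I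
        = ‖z x‖ * Complex.exp (((θ + (z x).arg : ℝ) : ℂ) * Complex.I) := by
      have h1 := Complex.norm_mul_exp_arg_mul_I (z x)
      have h2 : ((θ + (z x).arg : ℝ) : ℂ) * Complex.I
          = (z x).arg * Complex.I + θ * Complex.I := by push_cast; ring
      rw [h2, Complex.exp_add, ← mul_assoc, h1]
      simp only [z]
      rw [mul_assoc, ← Complex.exp_add]; simp
    have hre := congrArg Complex.re h
    have him := congrArg Complex.im h
    rw [Complex.re_ofReal_mul, Complex.exp_ofReal_mul_I_re] at hre
    rw [Complex.im_ofReal_mul, Complex.exp_ofReal_mul_I_im] at him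
    ext i
    fin_cases i
    · simpa using hre
    · simpa using him
  have hcont : ContinuousAt (fun x => (‖z x‖, θ + (z x).arg)) (polar r θ) := by
    refine ContinuousAt.prodMk hz.norm.continuousAt (continuousAt_const.add ?_)
    refine ContinuousAt.comp (g := Complex.arg) ?_ hz.continuousAt
    rw [hz0]
    exact Complex.continuousAt_arg (Complex.ofReal_mem_slitPlane.2 hr)
  have hval : (‖z (polar r θ)‖, θ + (z (polar r θ)).arg) = (r, θ) := by
    rw [hz0]; simp [abs_of_pos hr, Complex.arg_ofReal_of_nonneg hr.le]
  have := hcont.tendsto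
  rw [hval] at this
  filter_upwards [this.eventually hP] with x hxP
  exact ⟨_, _, hxP, hx x⟩

section Geometry

variable {θ₀ rs : ℝ} {r₁ r₂ : ℝ → ℝ}

theorem IsSpiral.isOpen_openPart (h : IsSpiral θ₀ rs r₁ r₂) {I : Set ℝ} (hI : IsOpen I)
    (hI0 : I ⊆ Ioi θ₀) : IsOpen (openPart r₁ r₂ I) := by
  rw [isOpen_iff_mem_nhds]
  rintro x ⟨θ, hθ, r, h1, h2, rfl⟩
  have hθ0 : θ₀ < θ := hI0 hθ
  have c1 : ContinuousAt r₁ θ := h.continuousOn_left.continuousAt (Ici_mem_nhds hθ0)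
  have c2 : ContinuousAt r₂ θ := h.continuousOn_right.continuousAt (Ici_mem_nhds hθ0)
  have hr : 0 < r := (h.pos_left θ hθ0.le).trans h1
  have key : ∀ᶠ p : ℝ × ℝ in 𝓝 (r, θ), p.2 ∈ I ∧ r₁ p.2 < p.1 ∧ p.1 < r₂ p.2 := by
    have t2 : Tendsto (fun p : ℝ × ℝ => p.2) (𝓝 (r, θ)) (𝓝 θ) := continuousAt_snd
    have t1 : Tendsto (fun p : ℝ × ℝ => p.1) (𝓝 (r, θ)) (𝓝 r) := continuousAt_fst
    exact (t2.eventually (hI.mem_nhds hθ)).and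
      (((c1.tendsto.comp t2).eventually_lt t1 h1).and (t1.eventually_lt (c2.tendsto.comp t2) h2))
  filter_upwards [eventually_exists_polar hr key] with x hx
  obtain ⟨s, φ, ⟨hφ, hs1, hs2⟩, rfl⟩ := hx
  exact ⟨φ, hφ, s, hs1, hs2, rfl⟩

theorem IsSpiral.isCompact_closedPart (h : IsSpiral θ₀ rs r₁ r₂) {a b : ℝ} (ha : θ₀ ≤ a) :
    IsCompact (closedPart r₁ r₂ (Icc a b)) := by
  have hsub : Icc a b ⊆ Ici θ₀ := fun x hx => ha.trans hx.1
  have c1 := h.continuousOn_left.mono hsub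
  have c2 := h.continuousOn_right.mono hsub
  -- Rescaling the radius to `[0, 1]` exhibits the set as the image of a compact rectangle.
  have : closedPart r₁ r₂ (Icc a b) =
      (fun p : ℝ × ℝ => polar (r₁ p.2 + p.1 * (r₂ p.2 - r₁ p.2)) p.2) '' (Icc 0 1 ×ˢ Icc a b) := by
    ext x
    constructor
    · rintro ⟨θ, hθ, r, h1, h2, rfl⟩
      have hpos : 0 < r₂ θ - r₁ θ := sub_pos.2 (h.nested θ (hsub hθ)).2
      refine ⟨((r - r₁ θ) / (r₂ θ - r₁ θ), θ), ⟨⟨div_nonneg (by linarith) hpos.le, ?_⟩, hθ⟩, ?_⟩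
      · rw [div_le_one hpos]; linarith
      · simp only
        congr 1
        field_simp; ring
    · rintro ⟨⟨t, θ⟩, ⟨⟨ht0, ht1⟩, hθ⟩, rfl⟩
      have hpos : 0 < r₂ θ - r₁ θ := sub_pos.2 (h.nested θ (hsub hθ)).2
      simp only at ht0 ht1 hθ
      exact ⟨θ, hθ, _, by nlinarith, by nlinarith, rfl⟩
  rw [this]
  refine (isCompact_Icc.prod isCompact_Icc).image_of_continuousOn ?_
  refine continuous_polar.comp_continuousOn (ContinuousOn.prodMk ?_ continuousOn_snd)
  have m : MapsTo (fun p : ℝ × ℝ => p.2) (Icc 0 1 ×ˢ Icc a b) (Icc a b) := fun p hp => hp.2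
  have d1 := c1.comp continuousOn_snd m
  have d2 := c2.comp continuousOn_snd m
  exact d1.add (continuousOn_fst.mul (d2.sub d1))

theorem closedPart_mono {I J : Set ℝ} (h : I ⊆ J) : closedPart r₁ r₂ I ⊆ closedPart r₁ r₂ J := by
  rintro x ⟨θ, hθ, hx⟩
  exact ⟨θ, h hθ, hx⟩

theorem openPart_mono {I J : Set ℝ} (h : I ⊆ J) : openPart r₁ r₂ I ⊆ openPart r₁ r₂ J := by
  rintro x ⟨θ, hθ, hx⟩
  exact ⟨θ, h hθ, hx⟩

theorem IsSpiral.isCompact_crossSection (h : IsSpiral θ₀ rs r₁ r₂) {θ : ℝ} (hθ : θ₀ ≤ θ) :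
    IsCompact (crossSection r₁ r₂ θ) := by
  have := h.isCompact_closedPart (b := θ) hθ
  rwa [Icc_self] at this

theorem IsSpiral.crossSection_nonempty (h : IsSpiral θ₀ rs r₁ r₂) {θ : ℝ} (hθ : θ₀ ≤ θ) :
    (crossSection r₁ r₂ θ).Nonempty :=
  ⟨polar (r₁ θ) θ, θ, rfl, r₁ θ, le_rfl, (h.nested θ hθ).2.le, rfl⟩

theorem crossSection_subset_UTilde {θ : ℝ} (hθ : θ₀ ≤ θ) :
    crossSection r₁ r₂ θ ⊆ UTilde θ₀ r₁ r₂ :=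
  closedPart_mono (by simpa using hθ)

theorem IsSpiral.le_sectionMax (h : IsSpiral θ₀ rs r₁ r₂) {f : Plane → ℝ}
    (hf : ContinuousOn f (UTilde θ₀ r₁ r₂)) {θ : ℝ} (hθ : θ₀ ≤ θ) {x : Plane}
    (hx : x ∈ crossSection r₁ r₂ θ) : f x ≤ sectionMax r₁ r₂ f θ :=
  le_csSup ((h.isCompact_crossSection hθ).bddAbove_image (hf.mono (crossSection_subset_UTilde hθ)))
    (mem_image_of_mem f hx)

theorem IsSpiral.sectionMax_le (h : IsSpiral θ₀ rs r₁ r₂) {f : Plane → ℝ} {θ K : ℝ} (hθ : θ₀ ≤ θ)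
    (hK : ∀ x ∈ crossSection r₁ r₂ θ, f x ≤ K) : sectionMax r₁ r₂ f θ ≤ K :=
  csSup_le ((h.crossSection_nonempty hθ).image f) (forall_mem_image.2 hK)

end Geometry

/-! ### The operator, its barriers, and its sign at a maximum -/

section Operator

variable {A : Plane → Matrix (Fin 2) (Fin 2) ℝ} {b : Plane → Plane}

theorem partialDeriv_neg (i : Fin 2) (u : Plane → ℝ) :
    partialDeriv i (-u) = -partialDeriv i u := by
  ext x
  simp [partialDeriv, fderiv_neg]

theorem ellipticOp_neg (u : Plane → ℝ) (x : Plane) :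
    ellipticOp A b (-u) x = -ellipticOp A b u x := by
  simp only [ellipticOp, partialDeriv_neg, Pi.neg_apply, mul_neg, Finset.sum_neg_distrib]
  ring

theorem differentiableAt_partialDeriv {u : Plane → ℝ} {x : Plane}
    (hu : ContDiffAt ℝ 2 u x) (i : Fin 2) : DifferentiableAt ℝ (partialDeriv i u) x := by
  have h : ContDiffAt ℝ 1 (fderiv ℝ u) x := hu.fderiv_right (by norm_num)
  exact (h.differentiableAt (by norm_num)).clm_apply (differentiableAt_const _)

theorem partialDeriv_add {u v : Plane → ℝ} {x : Plane} (hu : DifferentiableAt ℝ u x)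
    (hv : DifferentiableAt ℝ v x) (i : Fin 2) :
    partialDeriv i (u + v) x = partialDeriv i u x + partialDeriv i v x := by
  simp [partialDeriv, fderiv_add hu hv]

theorem ellipticOp_add {u v : Plane → ℝ} {x : Plane} (hu : ContDiffAt ℝ 2 u x)
    (hv : ContDiffAt ℝ 2 v x) :
    ellipticOp A b (u + v) x = ellipticOp A b u x + ellipticOp A b v x := by
  have h1 : ∀ i, partialDeriv i (u + v) x = partialDeriv i u x + partialDeriv i v x :=
    fun i => partialDeriv_add (hu.differentiableAt (by norm_num)) (hv.differentiableAt (by norm_num)) i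
  have h2 : ∀ i j, partialDeriv i (partialDeriv j (u + v)) x
      = partialDeriv i (partialDeriv j u) x + partialDeriv i (partialDeriv j v) x := by
    intro i j
    rw [← partialDeriv_add (differentiableAt_partialDeriv hu j)
      (differentiableAt_partialDeriv hv j)]
    have : partialDeriv j (u + v) =ᶠ[𝓝 x] partialDeriv j u + partialDeriv j v := by
      filter_upwards [hu.eventually (by norm_num), hv.eventually (by norm_num)] with y hy hz
      exact partialDeriv_add (hy.differentiableAt (by norm_num))
        (hz.differentiableAt (by norm_num)) j
    simp only [partialDeriv] at this ⊢
    rw [this.fderiv_eq]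
  simp only [ellipticOp, h1, h2, mul_add, Finset.sum_add_distrib]
  ring

/-- The exponential barrier `c exp(α ⟨e, x⟩)`. -/
noncomputable def expBarrier (c α : ℝ) (e : Plane) (x : Plane) : ℝ := c * Real.exp (α * inner ℝ e x)

theorem contDiff_expBarrier (c α : ℝ) (e : Plane) : ContDiff ℝ 2 (expBarrier c α e) := by
  unfold expBarrier
  exact contDiff_const.mul (contDiff_const.mul (contDiff_const.inner ℝ contDiff_id)).exp

theorem partialDeriv_expBarrier (c α : ℝ) (e : Plane) (i : Fin 2) :
    partialDeriv i (expBarrier c α e) = expBarrier (c * (α * e i)) α e := by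
  ext x
  have h1 : HasFDerivAt (fun y : Plane => inner ℝ e y) (innerSL ℝ e) x := (innerSL ℝ e).hasFDerivAt
  have h := ((h1.const_mul α).exp).const_mul c
  simp only [partialDeriv]
  unfold expBarrier
  rw [h.fderiv]
  simp [EuclideanSpace.inner_single_right]
  ring

theorem ellipticOp_expBarrier (c α : ℝ) (e x : Plane) :
    ellipticOp A b (expBarrier c α e) x
      = expBarrier c α e x * (α * (inner ℝ e (b x) - α * ∑ i, ∑ j, e i * A x i j * e j)) := by
  simp only [ellipticOp, partialDeriv_expBarrier]
  simp only [expBarrier, Fin.sum_univ_two, PiLp.inner_apply]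
  simp
  ring

/-- The second-order term is quadratic in `α` and the drift term linear, so a steep exponential
beats any bounded drift. -/
theorem ellipticOp_expBarrier_neg {c α c₀ B : ℝ} {e x : Plane} (hc : 0 < c) (hα : 0 < α)
    (he : ‖e‖ = 1) (hA : c₀ * ‖e‖ ^ 2 ≤ ∑ i, ∑ j, e i * A x i j * e j) (hb : ‖b x‖ ≤ B)
    (hB : B < α * c₀) : ellipticOp A b (expBarrier c α e) x < 0 := by
  rw [ellipticOp_expBarrier]
  have h1 : inner ℝ e (b x) ≤ B := by
    have := real_inner_le_norm e (b x)
    rw [he, one_mul] at this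
    exact this.trans hb
  rw [he] at hA
  refine mul_neg_of_pos_of_neg (mul_pos hc (Real.exp_pos _)) (mul_neg_of_pos_of_neg hα ?_)
  nlinarith

/-- A positive second derivative would make `x` a local minimum too, so `g` would be locally
constant with second derivative zero. -/
theorem deriv_deriv_nonpos_of_isLocalMax {g : ℝ → ℝ} {x : ℝ} (hg : IsLocalMax g x)
    (hc : ContinuousAt g x) : deriv (deriv g) x ≤ 0 := by
  by_contra! h
  have hmin := isLocalMin_of_deriv_deriv_pos h hg.deriv_eq_zero hc
  have hconst : g =ᶠ[𝓝 x] fun _ => g x := by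
    filter_upwards [hg, hmin] with y h1 h2
    exact le_antisymm h1 h2
  have : deriv g =ᶠ[𝓝 x] fun _ => 0 := by
    simpa using hconst.deriv
  rw [this.deriv_eq] at h
  simp at h

theorem sum_partialDeriv_nonpos_of_isLocalMax {u : Plane → ℝ} {x : Plane}
    (hu : ContDiffAt ℝ 2 u x) (hx : IsLocalMax u x) (v : Plane) :
    ∑ i, ∑ j, v i * v j * partialDeriv i (partialDeriv j u) x ≤ 0 := by
  let l : ℝ → Plane := fun t => x + t • v
  have hl : ∀ t, HasDerivAt l v t := fun t => by
    have := ((hasDerivAt_id t).smul_const v).const_add x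
    rwa [one_smul] at this
  have hl0 : l 0 = x := by simp [l]
  have hlt : Tendsto l (𝓝 0) (𝓝 x) := by
    have := (hl 0).continuousAt.tendsto
    rwa [hl0] at this
  have hv : v = ∑ i, v i • EuclideanSpace.single i (1 : ℝ) := by
    ext i; fin_cases i <;> simp [Fin.sum_univ_two]
  have hlin : ∀ T : Plane →L[ℝ] ℝ, T v = ∑ i, v i * T (EuclideanSpace.single i 1) := by
    intro T
    conv_lhs => rw [hv]
    simp
  have hg : IsLocalMax (u ∘ l) 0 := by
    have : ∀ᶠ y in 𝓝 x, u y ≤ u x := hx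
    have := hlt.eventually this
    simpa [IsLocalMax, IsMaxFilter, hl0] using this
  have hcont : ContinuousAt (u ∘ l) 0 := by
    refine ContinuousAt.comp ?_ (hl 0).continuousAt
    rw [hl0]; exact hu.continuousAt
  have key := deriv_deriv_nonpos_of_isLocalMax hg hcont
  have h1 : deriv (u ∘ l) =ᶠ[𝓝 0] fun t => ∑ j, v j * partialDeriv j u (l t) := by
    filter_upwards [hlt.eventually (hu.eventually (by norm_num))] with t ht
    have := (ht.differentiableAt (by norm_num)).hasFDerivAt.comp_hasDerivAt t (hl t)
    rw [this.deriv, hlin]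
    rfl
  have h2 : HasDerivAt (fun t => ∑ j, v j * partialDeriv j u (l t))
      (∑ j, v j * fderiv ℝ (partialDeriv j u) x v) 0 := by
    refine HasDerivAt.fun_sum fun j _ => HasDerivAt.const_mul _ ?_
    have hp := (differentiableAt_partialDeriv hu j).hasFDerivAt
    rw [← hl0] at hp
    have := hp.comp_hasDerivAt 0 (hl 0)
    rwa [hl0] at this
  rw [h1.deriv_eq, h2.deriv] at key
  refine le_trans (le_of_eq ?_) key
  simp only [hlin, Finset.mul_sum]
  rw [Finset.sum_comm]
  refine Finset.sum_congr rfl fun j _ => Finset.sum_congr rfl fun i _ => ?_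
  simp only [partialDeriv]
  ring

/-- Completing the square replaces diagonalization: `a₀₀ tr(A D²u)` is `D²u` evaluated on `(a₀₀,
a₀₁)` plus `det A` times `D²u` evaluated on `(0, 1)`. -/
theorem ellipticOp_nonneg_of_isLocalMax {u : Plane → ℝ} {x : Plane} {c₀ : ℝ}
    (hu : ContDiffAt ℝ 2 u x) (hx : IsLocalMax u x) (hsymm : (A x).IsSymm) (hc : 0 < c₀)
    (hA : ∀ ξ : Plane, c₀ * ‖ξ‖ ^ 2 ≤ ∑ i, ∑ j, ξ i * A x i j * ξ j) :
    0 ≤ ellipticOp A b u x := by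
  have hgrad : ∀ i, partialDeriv i u x = 0 := fun i => by simp [partialDeriv, hx.fderiv_eq_zero]
  have hs : A x 1 0 = A x 0 1 := hsymm.apply 0 1
  have h1 := hA !₂[1, 0]
  -- On this vector the quadratic form equals `a₀₀ det A`, which yields `det A ≥ 0`.
  have h2 := hA !₂[-(A x 0 1), A x 0 0]
  have k1 := sum_partialDeriv_nonpos_of_isLocalMax hu hx !₂[A x 0 0, A x 0 1]
  have k2 := sum_partialDeriv_nonpos_of_isLocalMax hu hx !₂[0, 1]
  simp only [ellipticOp, hgrad, mul_zero, Finset.sum_const_zero, add_zero]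
  simp [Fin.sum_univ_two, EuclideanSpace.norm_eq, hs] at h1 h2 k1 k2 ⊢
  have ha : 0 < A x 0 0 := hc.trans_le h1
  have h3 : 0 ≤ c₀ * Real.sqrt (A x 0 1 ^ 2 + A x 0 0 ^ 2) ^ 2 := by positivity
  have hdet : 0 ≤ A x 0 0 * A x 1 1 - A x 0 1 ^ 2 := by
    have : 0 ≤ A x 0 0 * (A x 0 0 * A x 1 1 - A x 0 1 ^ 2) := by nlinarith
    exact nonneg_of_mul_nonneg_right this ha
  have h5 := mul_nonpos_of_nonneg_of_nonpos hdet k2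
  have h6 : A x 0 0 * (A x 0 0 * partialDeriv 0 (partialDeriv 0 u) x
      + A x 0 1 * partialDeriv 0 (partialDeriv 1 u) x
      + (A x 0 1 * partialDeriv 1 (partialDeriv 0 u) x
        + A x 1 1 * partialDeriv 1 (partialDeriv 1 u) x)) ≤ 0 := by nlinarith
  have h7 := nonpos_of_mul_nonpos_right h6 ha
  linarith

end Operator

/-! ### The dichotomy for functions of one variable -/

theorem forall_ge_of_forall_Ico {P : ℝ → Prop} {t h : ℝ} (hh : 0 < h)
    (h0 : ∀ s ∈ Ico t (t + h), P s) (hstep : ∀ s, t ≤ s → P s → P (s + h)) :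
    ∀ s, t ≤ s → P s := by
  have hn : ∀ n : ℕ, ∀ s, t ≤ s → s < t + (n + 1) * h → P s := by
    intro n
    induction n with
    | zero =>
      intro s h1 h2
      exact h0 s ⟨h1, by simpa using h2⟩
    | succ n ih =>
      intro s h1 h2
      by_cases hs : s < t + h
      · exact h0 s ⟨h1, hs⟩
      · have := hstep (s - h) (by linarith) (ih (s - h) (by linarith) (by push_cast at h2; linarith))
        simpa using this
  intro s hs
  obtain ⟨n, hn'⟩ := exists_nat_gt ((s - t) / h)
  rw [div_lt_iff₀ hh] at hn'
  exact hn n s hs (by nlinarith)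

section

variable {θ₀ Θbar κ h T : ℝ} {m M : ℝ → ℝ}

theorem antitoneOn_rpow (hm : MonotoneOn m (Ici Θbar)) (hκ : 0 < κ) (hκ1 : κ < 1) :
    AntitoneOn (fun ζ => κ ^ m ζ) (Ici Θbar) := fun _ hx _ hy hxy =>
  Real.rpow_le_rpow_of_exponent_ge hκ hκ1.le (hm hx hy hxy)

theorem intervalIntegrable_rpow (hm : MonotoneOn m (Ici Θbar)) (hκ : 0 < κ) (hκ1 : κ < 1)
    {a b : ℝ} (ha : Θbar ≤ a) (hb : Θbar ≤ b) :
    IntervalIntegrable (fun ζ => κ ^ m ζ) MeasureTheory.volume a b :=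
  ((antitoneOn_rpow hm hκ hκ1).mono fun _ hx => (le_min ha hb).trans hx.1).intervalIntegrable

theorem integral_rpow_le (hm : MonotoneOn m (Ici Θbar)) (hκ : 0 < κ) (hκ1 : κ < 1)
    {a : ℝ} (ha : Θbar ≤ a) (hh : 0 ≤ h) : ∫ ζ in a..a + h, κ ^ m ζ ≤ h * κ ^ m a := by
  have : ∫ ζ in a..a + h, κ ^ m ζ ≤ ∫ _ in a..a + h, κ ^ m a :=
    intervalIntegral.integral_mono_on (by linarith)
      (intervalIntegrable_rpow hm hκ hκ1 ha (by linarith)) intervalIntegrable_const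
      fun x hx => antitoneOn_rpow hm hκ hκ1 ha (ha.trans hx.1) hx.1
  simpa using this

/-- Integrability is not required, so this also covers angles below `Θbar`, where `m` is arbitrary.
-/
theorem integral_rpow_nonneg (m : ℝ → ℝ) (hκ : 0 < κ) {a b : ℝ} (hab : a ≤ b) :
    0 ≤ ∫ ζ in a..b, κ ^ m ζ :=
  intervalIntegral.integral_nonneg hab fun _ _ => Real.rpow_nonneg hκ.le _

theorem decays_of_antitoneOn (hm : MonotoneOn m (Ici Θbar)) (hκ : 0 < κ) (hκ1 : κ < 1)
    (hdiv : Tendsto (fun T : ℝ => ∫ ζ in Θbar..T, κ ^ m ζ) atTop atTop)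
    (h0 : θ₀ ≤ Θbar) (hh : 0 < h) (hT : Θbar ≤ T - h) (hM : ∀ θ, θ₀ ≤ θ → 0 ≤ M θ)
    (hanti : AntitoneOn M (Ici θ₀))
    (hg : ∀ θ, T ≤ θ → M θ ≤ (1 - κ ^ m (θ + h) / 2) * max (M (θ - h)) (M (θ + h))) :
    Decays θ₀ (T + 2 * h) (1 / (2 * h)) κ m M := by
  set ν := 1 / (2 * h) with hν
  have hνpos : 0 < ν := by positivity
  have hνh : ∀ g, ν * (h * g) = g / 2 := fun g => by rw [hν]; field_simp
  have ii : ∀ {a b : ℝ}, Θbar ≤ a → Θbar ≤ b →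
      IntervalIntegrable (fun ζ => κ ^ m ζ) MeasureTheory.volume a b :=
    fun ha hb => intervalIntegrable_rpow hm hκ hκ1 ha hb
  have hM0 := hM θ₀ le_rfl
  -- The upper limit is shifted by `2 * h` because the step from `s` to `s + h` gains `κ ^ m (s + 2
  -- * h) / 2`, which controls the integral only to the right of `s + 2 * h`. The choice of `ν`
  -- makes `ν * h = 1 / 2`.
  have main : ∀ s, T - h ≤ s →
      M s ≤ M θ₀ * Real.exp (-ν * ∫ ζ in (T + 2 * h)..s + 2 * h, κ ^ m ζ) := by
    refine forall_ge_of_forall_Ico hh ?_ ?_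
    · rintro s ⟨hs1, hs2⟩
      have hI := integral_rpow_nonneg m hκ (a := s + 2 * h) (b := T + 2 * h) (by linarith)
      rw [intervalIntegral.integral_symm]
      have : 1 ≤ Real.exp (-ν * -∫ ζ in s + 2 * h..T + 2 * h, κ ^ m ζ) :=
        Real.one_le_exp (by nlinarith)
      have h1 : M s ≤ M θ₀ := hanti (by simp) (by simp; linarith) (by linarith)
      nlinarith
    · intro s hs ih
      have h1 := hg (s + h) (by linarith)
      have e1 : s + h - h = s := by ring
      have e2 : s + h + h = s + 2 * h := by ring
      have e3 : s + h + 2 * h = s + 2 * h + h := by ring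
      rw [e1, e2, max_eq_left (hanti (by simp; linarith) (by simp; linarith) (by linarith))] at h1
      have h2 := integral_rpow_le hm hκ hκ1 (a := s + 2 * h) (by linarith) hh.le
      have h3 := Real.add_one_le_exp (-(κ ^ m (s + 2 * h) / 2))
      have h4 : M (s + h) ≤ Real.exp (-(κ ^ m (s + 2 * h) / 2)) * M s :=
        h1.trans (mul_le_mul_of_nonneg_right (by linarith) (hM s (by linarith)))
      rw [e3, ← intervalIntegral.integral_add_adjacent_intervals
        (ii (by linarith) (by linarith)) (ii (b := s + 2 * h + h) (a := s + 2 * h) (by linarith)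
          (by linarith)), mul_add, Real.exp_add]
      have h5 : Real.exp (-(κ ^ m (s + 2 * h) / 2))
          ≤ Real.exp (-ν * ∫ ζ in s + 2 * h..s + 2 * h + h, κ ^ m ζ) := by
        apply Real.exp_le_exp.2
        have := mul_le_mul_of_nonneg_left h2 hνpos.le
        rw [hνh] at this
        linarith
      calc M (s + h) ≤ Real.exp (-(κ ^ m (s + 2 * h) / 2)) * M s := h4
        _ ≤ _ * _ := mul_le_mul h5 ih (hM s (by linarith)) (Real.exp_pos _).le
        _ = _ := by ring
  have bound : ∀ θ, θ₀ ≤ θ →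
      M θ ≤ M θ₀ * min 1 (Real.exp (-ν * ∫ ζ in (T + 2 * h)..θ, κ ^ m ζ)) := by
    intro θ hθ
    have h1 : M θ ≤ M θ₀ := hanti (by simp) hθ hθ
    rw [mul_min_of_nonneg _ _ hM0, mul_one]
    refine le_min h1 ?_
    rcases le_total θ (T + 2 * h) with hle | hle
    · have hI := integral_rpow_nonneg m hκ hle
      rw [intervalIntegral.integral_symm]
      have : 1 ≤ Real.exp (-ν * -∫ ζ in θ..T + 2 * h, κ ^ m ζ) :=
        Real.one_le_exp (by nlinarith)
      nlinarith
    · refine (main θ (by linarith)).trans (mul_le_mul_of_nonneg_left (Real.exp_le_exp.2 ?_) hM0)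
      rw [← intervalIntegral.integral_add_adjacent_intervals (b := θ)
        (ii (by linarith) (by linarith)) (ii (by linarith) (by linarith))]
      have := integral_rpow_nonneg m hκ (a := θ) (b := θ + 2 * h) (by linarith)
      nlinarith
  refine ⟨bound, ?_⟩
  have hlim : Tendsto (fun θ => M θ₀ * Real.exp (-ν * ∫ ζ in (T + 2 * h)..θ, κ ^ m ζ))
      atTop (𝓝 0) := by
    have h1 : Tendsto (fun θ => ∫ ζ in (T + 2 * h)..θ, κ ^ m ζ) atTop atTop := by
      refine (tendsto_atTop_add_const_left _ (∫ ζ in (T + 2 * h)..Θbar, κ ^ m ζ) hdiv).congr' ?_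
      filter_upwards [eventually_ge_atTop Θbar] with θ hθ
      exact intervalIntegral.integral_add_adjacent_intervals
        (ii (by linarith) le_rfl) (ii le_rfl hθ)
    have h2 := Real.tendsto_exp_atBot.comp (h1.const_mul_atTop_of_neg (neg_lt_zero.2 hνpos))
    simpa using h2.const_mul (M θ₀)
  refine tendsto_of_tendsto_of_tendsto_of_le_of_le' tendsto_const_nhds hlim ?_ ?_
  · filter_upwards [eventually_ge_atTop θ₀] with θ hθ using hM θ hθ
  · filter_upwards [eventually_ge_atTop θ₀] with θ hθ
    exact (bound θ hθ).trans (mul_le_mul_of_nonneg_left (min_le_right _ _) hM0)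

theorem grows_of_monotoneOn (hm : MonotoneOn m (Ici Θbar)) (hκ : 0 < κ) (hκ1 : κ < 1)
    (hdiv : Tendsto (fun T : ℝ => ∫ ζ in Θbar..T, κ ^ m ζ) atTop atTop)
    (hh : 0 < h) (hT : Θbar ≤ T - h) {d : ℝ} (hM : 0 < M d)
    (hmono : MonotoneOn M (Ici d))
    (hg : ∀ θ, T ≤ θ → M θ ≤ (1 - κ ^ m (θ + h) / 2) * max (M (θ - h)) (M (θ + h))) :
    Grows Θbar (1 / (2 * h)) κ m M := by
  set ν := 1 / (2 * h) with hν
  have hνpos : 0 < ν := by positivity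
  have hνh : ∀ g, ν * (h * g) = g / 2 := fun g => by rw [hν]; field_simp
  have ii : ∀ {a b : ℝ}, Θbar ≤ a → Θbar ≤ b →
      IntervalIntegrable (fun ζ => κ ^ m ζ) MeasureTheory.volume a b :=
    fun ha hb => intervalIntegrable_rpow hm hκ hκ1 ha hb
  set t := max T (d + h) with ht
  have htT : T ≤ t := le_max_left _ _
  have htd : d + h ≤ t := le_max_right _ _
  -- `C` absorbs the integral up to `t + 2 * h`, so that the claim holds on the first period, where
  -- `s + h < t + 2 * h`.
  set C := M d * Real.exp (-ν * ∫ ζ in Θbar..t + 2 * h, κ ^ m ζ) with hC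
  have hCpos : 0 < C := mul_pos hM (Real.exp_pos _)
  have main : ∀ s, t ≤ s → C * Real.exp (ν * ∫ ζ in Θbar..s + h, κ ^ m ζ) ≤ M s := by
    refine forall_ge_of_forall_Ico hh ?_ ?_
    · rintro s ⟨hs1, hs2⟩
      have h1 : M d ≤ M s := hmono (by simp) (by simp; linarith) (by linarith)
      refine le_trans ?_ h1
      rw [hC, mul_assoc, ← Real.exp_add]
      refine mul_le_of_le_one_right hM.le (Real.exp_le_one_iff.2 ?_)
      have h2 := integral_rpow_nonneg m hκ (a := s + h) (b := t + 2 * h) (by linarith)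
      rw [← intervalIntegral.integral_add_adjacent_intervals (b := s + h) (c := t + 2 * h)
        (ii le_rfl (by linarith)) (ii (by linarith) (by linarith))]
      nlinarith
    · intro s hs ih
      have h1 := hg s (by linarith)
      rw [max_eq_right (hmono (by simp; linarith) (by simp; linarith) (by linarith))] at h1
      have h2 := integral_rpow_le hm hκ hκ1 (a := s + h) (by linarith) hh.le
      have h3 := Real.add_one_le_exp (-(κ ^ m (s + h) / 2))
      have hMs : 0 ≤ M (s + h) :=
        hM.le.trans (hmono (by simp) (by simp; linarith) (by linarith))
      have h4 : M s ≤ Real.exp (-(κ ^ m (s + h) / 2)) * M (s + h) :=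
        h1.trans (mul_le_mul_of_nonneg_right (by linarith) hMs)
      rw [← intervalIntegral.integral_add_adjacent_intervals (b := s + h)
        (ii le_rfl (by linarith)) (ii (by linarith) (by linarith)), mul_add, Real.exp_add]
      have h5 : Real.exp (ν * ∫ ζ in s + h..s + h + h, κ ^ m ζ)
          ≤ Real.exp (κ ^ m (s + h) / 2) := by
        apply Real.exp_le_exp.2
        rw [← hνh]
        exact mul_le_mul_of_nonneg_left h2 hνpos.le
      calc C * (Real.exp (ν * ∫ ζ in Θbar..s + h, κ ^ m ζ)
              * Real.exp (ν * ∫ ζ in s + h..s + h + h, κ ^ m ζ))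
          = (C * Real.exp (ν * ∫ ζ in Θbar..s + h, κ ^ m ζ))
              * Real.exp (ν * ∫ ζ in s + h..s + h + h, κ ^ m ζ) := by ring
        _ ≤ (Real.exp (-(κ ^ m (s + h) / 2)) * M (s + h)) * Real.exp (κ ^ m (s + h) / 2) :=
            mul_le_mul (ih.trans h4) h5 (Real.exp_pos _).le
              (mul_nonneg (Real.exp_pos _).le hMs)
        _ = M (s + h) := by
            rw [mul_right_comm, ← Real.exp_add]; simp
  have bound : ∀ s, t ≤ s → C * Real.exp (ν * ∫ ζ in Θbar..s, κ ^ m ζ) ≤ M s := by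
    intro s hs
    refine le_trans (mul_le_mul_of_nonneg_left (Real.exp_le_exp.2 ?_) hCpos.le) (main s hs)
    rw [← intervalIntegral.integral_add_adjacent_intervals (b := s) (c := s + h)
      (ii le_rfl (by linarith)) (ii (by linarith) (by linarith))]
    have := integral_rpow_nonneg m hκ (a := s) (b := s + h) (by linarith)
    nlinarith
  refine ⟨⟨C, hCpos, t, bound⟩, ?_⟩
  refine tendsto_atTop_mono' atTop (eventually_atTop.2 ⟨t, bound⟩) ?_
  exact (Real.tendsto_exp_atTop.comp (hdiv.const_mul_atTop hνpos)).const_mul_atTop hCpos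

/-- A nonnegative function on a half-line that obeys the maximum principle and contracts at every
step by the factor `1 - κ ^ m / 2` either decays or grows. -/
theorem decays_or_grows (hm : MonotoneOn m (Ici Θbar)) (hκ : 0 < κ) (hκ1 : κ < 1)
    (hdiv : Tendsto (fun T : ℝ => ∫ ζ in Θbar..T, κ ^ m ζ) atTop atTop)
    (h0 : θ₀ ≤ Θbar) (hh : 0 < h) (hT : Θbar ≤ T - h) (hM : ∀ θ, θ₀ ≤ θ → 0 ≤ M θ)
    (hmax : ∀ a θ b, θ₀ ≤ a → a ≤ θ → θ ≤ b → M θ ≤ max (M a) (M b))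
    (hg : ∀ θ, T ≤ θ → M θ ≤ (1 - κ ^ m (θ + h) / 2) * max (M (θ - h)) (M (θ + h))) :
    Decays θ₀ (T + 2 * h) (1 / (2 * h)) κ m M ∨ Grows Θbar (1 / (2 * h)) κ m M := by
  by_cases hanti : AntitoneOn M (Ici θ₀)
  · exact Or.inl (decays_of_antitoneOn hm hκ hκ1 hdiv h0 hh hT hM hanti hg)
  · right
    simp only [AntitoneOn, not_forall, not_le] at hanti
    obtain ⟨a, ha, d, -, had, hlt⟩ := hanti
    refine grows_of_monotoneOn hm hκ hκ1 hdiv hh hT (d := d) ((hM a ha).trans_lt hlt) ?_ hg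
    -- Since `M a < M d`, the bound by the two ends must come from the right end; the same argument
    -- then applies at every later angle.
    have hge : ∀ x, d ≤ x → M d ≤ M x := fun x hx =>
      (le_max_iff.1 (hmax a d x ha had hx)).resolve_left (not_le.2 hlt)
    intro x hx y hy hxy
    exact (le_max_iff.1 (hmax a x y ha (had.trans hx) hxy)).resolve_left
      (not_le.2 (hlt.trans_le (hge x hx)))

end

/-! ### Maximum principles on the strip and the half-turn contraction -/

section MaximumPrinciple

variable {θ₀ rs Θbar κ c₀ : ℝ} {r₁ r₂ m : ℝ → ℝ} {A : Plane → Matrix (Fin 2) (Fin 2) ℝ}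
  {b : Plane → Plane} {u : Plane → ℝ}

theorem DriftBound.exists_bound (hb : DriftBound θ₀ r₁ r₂ b Θbar κ m) (T : ℝ) :
    ∃ B, ∀ x ∈ openPart r₁ r₂ (Ioo θ₀ T), ‖b x‖ ≤ B := by
  obtain ⟨B, hB⟩ := hb.bounded_initial
  refine ⟨max B (m T), ?_⟩
  rintro x ⟨θ, hθ, r, h1, h2, rfl⟩
  have hU : polar r θ ∈ U θ₀ r₁ r₂ := ⟨θ, hθ.1, r, h1, h2, rfl⟩
  rcases le_total θ Θbar with h | h
  · exact (hB _ ⟨hU, θ, ⟨hθ.1.le, h⟩, r, h1, h2, rfl⟩).trans (le_max_left _ _)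
  · exact ((hb.bound θ h _ ⟨hU, θ, rfl, r, h1.le, h2.le, rfl⟩).trans
      (hb.monotone h (h.trans hθ.2.le) hθ.2.le)).trans (le_max_right _ _)

/-- Maximum principle on the strip for a subsolution to which an exponential has been added that is
steep enough to be a strict subsolution. -/
theorem IsSpiral.add_expBarrier_le (hdom : IsSpiral θ₀ rs r₁ r₂)
    (hsymm : ∀ x ∈ U θ₀ r₁ r₂, (A x).IsSymm) (hc₀ : 0 < c₀)
    (hA : ∀ x ∈ U θ₀ r₁ r₂, ∀ ξ : Plane, c₀ * ‖ξ‖ ^ 2 ≤ ∑ i, ∑ j, ξ i * A x i j * ξ j)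
    (hu : Admissible θ₀ r₁ r₂ u) (hL : ∀ x ∈ U θ₀ r₁ r₂, ellipticOp A b u x ≤ 0)
    {s t B c α K : ℝ} {e : Plane} (hs : θ₀ ≤ s) (hst : s ≤ t)
    (hB : ∀ x ∈ openPart r₁ r₂ (Ioo s t), ‖b x‖ ≤ B)
    (hc : 0 < c) (hα : 0 < α) (he : ‖e‖ = 1) (hαB : B < α * c₀)
    (hlat : ∀ θ ∈ Icc s t, ∀ r, r = r₁ θ ∨ r = r₂ θ →
      u (polar r θ) + expBarrier c α e (polar r θ) ≤ K)
    (hend : ∀ θ, θ = s ∨ θ = t → ∀ x ∈ crossSection r₁ r₂ θ, u x + expBarrier c α e x ≤ K) :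
    ∀ x ∈ closedPart r₁ r₂ (Icc s t), u x + expBarrier c α e x ≤ K := by
  have hE := contDiff_expBarrier c α e
  have hsub : closedPart r₁ r₂ (Icc s t) ⊆ UTilde θ₀ r₁ r₂ :=
    closedPart_mono fun x hx => hs.trans hx.1
  have hcont : ContinuousOn (u + expBarrier c α e) (closedPart r₁ r₂ (Icc s t)) :=
    (hu.2.mono hsub).add hE.continuous.continuousOn
  have hne : (closedPart r₁ r₂ (Icc s t)).Nonempty :=
    (hdom.crossSection_nonempty hs).mono (closedPart_mono (by simpa using hst))
  obtain ⟨x₀, hx₀, hmax⟩ := (hdom.isCompact_closedPart hs).exists_isMaxOn hne hcont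
  suffices h : (u + expBarrier c α e) x₀ ≤ K from fun x hx => (hmax hx).trans h
  obtain ⟨θ, hθ, r, h1, h2, rfl⟩ := hx₀
  rcases h1.eq_or_lt with h1 | h1
  · exact hlat θ hθ r (Or.inl h1.symm)
  rcases h2.eq_or_lt with h2 | h2
  · exact hlat θ hθ r (Or.inr h2)
  rcases hθ.1.eq_or_lt with h3 | h3
  · exact hend θ (Or.inl h3.symm) _ ⟨θ, rfl, r, h1.le, h2.le, rfl⟩
  rcases hθ.2.eq_or_lt with h4 | h4
  · exact hend θ (Or.inr h4) _ ⟨θ, rfl, r, h1.le, h2.le, rfl⟩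
  -- At an interior maximum the operator is nonnegative on the sum, whereas the barrier is a strict
  -- subsolution.
  exfalso
  set x := polar r θ
  have hxo : x ∈ openPart r₁ r₂ (Ioo s t) := ⟨θ, ⟨h3, h4⟩, r, h1, h2, rfl⟩
  have hxU : x ∈ U θ₀ r₁ r₂ := openPart_mono (fun y hy => hs.trans_lt hy.1) hxo
  have hnhds : closedPart r₁ r₂ (Icc s t) ∈ 𝓝 x := by
    refine mem_of_superset ((hdom.isOpen_openPart isOpen_Ioo
      (fun y hy => hs.trans_lt hy.1)).mem_nhds hxo) ?_
    rintro y ⟨φ, hφ, q, hq1, hq2, rfl⟩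
    exact ⟨φ, Ioo_subset_Icc_self hφ, q, hq1.le, hq2.le, rfl⟩
  have hloc : IsLocalMax (u + expBarrier c α e) x := hmax.isLocalMax hnhds
  have hux : ContDiffAt ℝ 2 u x :=
    hu.1.contDiffAt ((hdom.isOpen_openPart isOpen_Ioi le_rfl).mem_nhds hxU)
  have hpos : 0 ≤ ellipticOp A b (u + expBarrier c α e) x := ellipticOp_nonneg_of_isLocalMax (hux.add hE.contDiffAt) hloc
    (hsymm x hxU) hc₀ (hA x hxU)
  rw [ellipticOp_add hux hE.contDiffAt] at hpos
  have hneg := ellipticOp_expBarrier_neg hc hα he (hA x hxU e) (hB x hxo) hαB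
  linarith [hL x hxU]

/-- Weak maximum principle on the strip. -/
theorem IsSpiral.le_of_le_ends (hdom : IsSpiral θ₀ rs r₁ r₂)
    (hsymm : ∀ x ∈ U θ₀ r₁ r₂, (A x).IsSymm) (hc₀ : 0 < c₀)
    (hA : ∀ x ∈ U θ₀ r₁ r₂, ∀ ξ : Plane, c₀ * ‖ξ‖ ^ 2 ≤ ∑ i, ∑ j, ξ i * A x i j * ξ j)
    (hb : DriftBound θ₀ r₁ r₂ b Θbar κ m)
    (hu : Admissible θ₀ r₁ r₂ u) (hL : ∀ x ∈ U θ₀ r₁ r₂, ellipticOp A b u x ≤ 0)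
    (hγ : ∀ x ∈ lateral θ₀ r₁ r₂, u x ≤ 0)
    {s θ t N : ℝ} (hs : θ₀ ≤ s) (hsθ : s ≤ θ) (hθt : θ ≤ t) (hN : 0 ≤ N)
    (h1 : ∀ x ∈ crossSection r₁ r₂ s, u x ≤ N) (h2 : ∀ x ∈ crossSection r₁ r₂ t, u x ≤ N) :
    ∀ x ∈ crossSection r₁ r₂ θ, u x ≤ N := by
  obtain ⟨B, hB⟩ := hb.exists_bound t
  set α := (|B| + 1) / c₀ with hα
  have hαpos : 0 < α := by positivity
  have hαB : B < α * c₀ := by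
    rw [hα, div_mul_cancel₀ _ hc₀.ne']
    linarith [le_abs_self B]
  have hst := hsθ.trans hθt
  set E := expBarrier 1 α (polar 1 0) with hEdef
  have hE : ContinuousOn E (closedPart r₁ r₂ (Icc s t)) :=
    (contDiff_expBarrier _ _ _).continuous.continuousOn
  obtain ⟨D, hD⟩ := (hdom.isCompact_closedPart hs).bddAbove_image hE
  have hD' : ∀ x ∈ closedPart r₁ r₂ (Icc s t), E x ≤ D := fun x hx => hD (mem_image_of_mem E hx)
  have hEpos : ∀ x, 0 < E x := fun x => mul_pos one_pos (Real.exp_pos _)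
  have hmem : ∀ φ ∈ Icc s t, crossSection r₁ r₂ φ ⊆ closedPart r₁ r₂ (Icc s t) := fun φ hφ =>
    closedPart_mono (by simpa using hφ)
  intro x hx
  have hxc := hmem θ ⟨hsθ, hθt⟩ hx
  have hDpos : 0 < D := (hEpos x).trans_le (hD' x hxc)
  refine le_of_forall_pos_le_add fun ε hε => ?_
  -- The barrier only supplies strictness: scaled by `ε / D` it stays below `ε`, which is arbitrary.
  have hc : 0 < ε / D := by positivity
  have hcE : ∀ y, expBarrier (ε / D) α (polar 1 0) y = ε / D * E y := fun y => by
    simp [hEdef, expBarrier]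
  have hle : ∀ y ∈ closedPart r₁ r₂ (Icc s t), expBarrier (ε / D) α (polar 1 0) y ≤ ε := by
    intro y hy
    rw [hcE]
    calc ε / D * E y ≤ ε / D * D := mul_le_mul_of_nonneg_left (hD' y hy) hc.le
      _ = ε := div_mul_cancel₀ _ hDpos.ne'
  have key := hdom.add_expBarrier_le hsymm hc₀ hA hu hL (K := N + ε) hs hst
    (fun y hy => hB y (openPart_mono (Ioo_subset_Ioo_left hs) hy)) hc hαpos (norm_polar_one 0) hαB
    ?_ ?_ x hxc
  · rw [hcE] at key
    have := mul_pos hc (hEpos x)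
    linarith
  · intro φ hφ r hr
    have hφ0 : θ₀ ≤ φ := hs.trans hφ.1
    have hlt := (hdom.nested φ hφ0).2
    have hm : polar r φ ∈ closedPart r₁ r₂ (Icc s t) := by
      refine ⟨φ, hφ, r, ?_, ?_, rfl⟩ <;> rcases hr with rfl | rfl <;> first | exact le_rfl | exact hlt.le
    have hl : polar r φ ∈ lateral θ₀ r₁ r₂ := ⟨φ, hφ0, by rcases hr with rfl | rfl <;> simp⟩
    linarith [hγ _ hl, hle _ hm]
  · rintro φ (rfl | rfl) y hy
    · linarith [h1 y hy, hle y (hmem _ ⟨le_rfl, hst⟩ hy)]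
    · linarith [h2 y hy, hle y (hmem _ ⟨hst, le_rfl⟩ hy)]

/-- Where the strip is thin compared with the drift, a subsolution contracts by the factor
`1 - κ ^ m / 2` between the ends of a half-turn and its middle. -/
theorem IsSpiral.le_mul_of_le_ends (hdom : IsSpiral θ₀ rs r₁ r₂)
    (hsymm : ∀ x ∈ U θ₀ r₁ r₂, (A x).IsSymm) (hc₀ : 0 < c₀)
    (hA : ∀ x ∈ U θ₀ r₁ r₂, ∀ ξ : Plane, c₀ * ‖ξ‖ ^ 2 ≤ ∑ i, ∑ j, ξ i * A x i j * ξ j)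
    (hb : DriftBound θ₀ r₁ r₂ b Θbar κ m)
    (hu : Admissible θ₀ r₁ r₂ u) (hL : ∀ x ∈ U θ₀ r₁ r₂, ellipticOp A b u x ≤ 0)
    (hγ : ∀ x ∈ lateral θ₀ r₁ r₂, u x ≤ 0)
    {ε θ N : ℝ} (hθ : Θbar ≤ θ - Real.pi / 2) (hε : ε ≤ rs / 2)
    (hεκ : 4 * ε / c₀ ≤ -Real.log κ)
    (hm : c₀ ≤ m (θ + Real.pi / 2) * rs)
    (hr₁ : ∀ φ, θ - Real.pi / 2 ≤ φ → rs - ε ≤ r₁ φ)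
    (hr₂ : ∀ φ, θ - Real.pi / 2 ≤ φ → r₂ φ ≤ rs + ε) (hN : 0 ≤ N)
    (h1 : ∀ x ∈ crossSection r₁ r₂ (θ - Real.pi / 2), u x ≤ N)
    (h2 : ∀ x ∈ crossSection r₁ r₂ (θ + Real.pi / 2), u x ≤ N) :
    ∀ x ∈ crossSection r₁ r₂ θ, u x ≤ (1 - κ ^ m (θ + Real.pi / 2) / 2) * N := by
  have hpi := Real.pi_pos
  have hθ₀ : θ₀ ≤ θ - Real.pi / 2 := hb.le_start.trans hθ
  -- The barrier's coefficient is proportional to `N`, so `N = 0` is left to the weak principle.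
  rcases hN.eq_or_lt with rfl | hNpos
  · rw [mul_zero]
    exact hdom.le_of_le_ends hsymm hc₀ hA hb hu hL hγ hθ₀ (by linarith) (by linarith) le_rfl h1 h2
  set μ := m (θ + Real.pi / 2) with hμ
  have hrs := hdom.limit_pos
  have hμpos : 0 < μ := pos_of_mul_pos_left (hc₀.trans_le hm) hrs.le
  set α := 2 * μ / c₀ with hα
  have hαpos : 0 < α := by positivity
  have hαc : α * c₀ = 2 * μ := div_mul_cancel₀ _ hc₀.ne'
  have hαrs : 2 ≤ α * rs := by
    rw [hα, div_mul_eq_mul_div, le_div_iff₀ hc₀]; linarith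
  -- Normalized so that the barrier is at most `N` for radii up to `rs + ε`.
  set c := N * Real.exp (-(α * (rs + ε))) with hc
  have hcpos : 0 < c := mul_pos hNpos (Real.exp_pos _)
  have hB : ∀ x ∈ openPart r₁ r₂ (Ioo (θ - Real.pi / 2) (θ + Real.pi / 2)), ‖b x‖ ≤ μ := by
    rintro x ⟨φ, hφ, r, h1, h2, rfl⟩
    have hφ' : Θbar ≤ φ := hθ.trans hφ.1.le
    exact (hb.bound φ hφ' _ ⟨⟨φ, hθ₀.trans_lt hφ.1, r, h1, h2, rfl⟩, φ, rfl, r, h1.le, h2.le,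
      rfl⟩).trans (hb.monotone hφ' (hφ'.trans hφ.2.le) hφ.2.le)
  rintro x ⟨φ, rfl, r, hx1, hx2, rfl⟩
  have key := hdom.add_expBarrier_le hsymm hc₀ hA hu hL (K := N + c) hθ₀
    (by linarith : φ - Real.pi / 2 ≤ φ + Real.pi / 2) hB hcpos hαpos (norm_polar_one φ)
    (by rw [hαc]; linarith) ?_ ?_ (polar r φ)
    ⟨φ, ⟨by linarith, by linarith⟩, r, hx1, hx2, rfl⟩
  · rw [expBarrier, inner_polar, sub_self, Real.cos_zero, mul_one] at key
    have hr : rs - ε ≤ r := (hr₁ φ (by linarith)).trans hx1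
    have e1 : N * Real.exp (-(2 * α * ε)) ≤ c * Real.exp (α * r) := by
      rw [hc, mul_assoc N, ← Real.exp_add]
      refine mul_le_mul_of_nonneg_left (Real.exp_le_exp.2 ?_) hN
      nlinarith
    -- From `2 ≤ α * rs` and `ε ≤ rs / 2` follows `α * (rs - ε) ≥ 1`, and `exp(-1) ≤ 1 / 2`: the
    -- excess `c` costs at most half of the gain.
    have e2 : c ≤ N * (Real.exp (-(2 * α * ε)) / 2) := by
      refine mul_le_mul_of_nonneg_left ?_ hN
      have : Real.exp (-(α * (rs + ε))) ≤ Real.exp (-(2 * α * ε)) * Real.exp (-1) := by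
        rw [← Real.exp_add]
        exact Real.exp_le_exp.2 (by nlinarith)
      have h3 : Real.exp (-1) ≤ 1 / 2 := by
        have := Real.add_one_le_exp (1 : ℝ)
        rw [Real.exp_neg, one_div]
        exact inv_anti₀ (by norm_num) (by linarith)
      nlinarith [Real.exp_pos (-(2 * α * ε))]
    have e3 : κ ^ μ ≤ Real.exp (-(2 * α * ε)) := by
      rw [Real.rpow_def_of_pos hb.kappa_pos]
      refine Real.exp_le_exp.2 ?_
      have : 2 * α * ε = 4 * ε / c₀ * μ := by rw [hα]; ring
      rw [this]
      nlinarith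
    have e4 := mul_le_mul_of_nonneg_left e3 hN
    nlinarith
  · intro ψ hψ q hq
    have hψ0 : θ₀ ≤ ψ := hθ₀.trans hψ.1
    have hlt := (hdom.nested ψ hψ0).2
    have hl : polar q ψ ∈ lateral θ₀ r₁ r₂ := ⟨ψ, hψ0, by rcases hq with rfl | rfl <;> simp⟩
    have hq0 : 0 < q := by
      rcases hq with rfl | rfl
      exacts [hdom.pos_left ψ hψ0, hdom.pos_right ψ hψ0]
    have hq1 : q ≤ rs + ε := by
      have := hr₂ ψ hψ.1
      rcases hq with rfl | rfl
      exacts [hlt.le.trans this, this]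
    have hE : expBarrier c α (polar 1 φ) (polar q ψ) ≤ N := by
      rw [expBarrier, inner_polar, hc, mul_assoc, ← Real.exp_add]
      refine mul_le_of_le_one_right hN (Real.exp_le_one_iff.2 ?_)
      have : q * Real.cos (ψ - φ) ≤ rs + ε :=
        (mul_le_of_le_one_right hq0.le (Real.cos_le_one _)).trans hq1
      nlinarith
    linarith [hγ _ hl]
  · rintro ψ hψ y hy
    have huy : u y ≤ N := by
      rcases hψ with rfl | rfl
      exacts [h1 y hy, h2 y hy]
    obtain ⟨ψ', hψ', q, -, -, rfl⟩ := hy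
    obtain rfl : ψ' = ψ := hψ'
    -- This is why the step is a quarter-turn on each side: the end sections are orthogonal to `e`.
    have hcos : Real.cos (ψ' - φ) = 0 := by
      rcases hψ with rfl | rfl <;> simp
    have hE : expBarrier c α (polar 1 φ) (polar q ψ') = c := by
      simp [expBarrier, inner_polar, hcos]
    rw [hE]
    linarith

/-- The angle beyond which the strip is thin compared with the drift. -/
theorem IsSpiral.exists_thin (hdom : IsSpiral θ₀ rs r₁ r₂) (hc₀ : 0 < c₀)
    (hb : DriftBound θ₀ r₁ r₂ b Θbar κ m) :
    ∃ ε T, Θbar ≤ T ∧ ε ≤ rs / 2 ∧ 4 * ε / c₀ ≤ -Real.log κ ∧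
      (∀ φ, T ≤ φ → c₀ ≤ m φ * rs) ∧ (∀ φ, T ≤ φ → rs - ε ≤ r₁ φ) ∧
      ∀ φ, T ≤ φ → r₂ φ ≤ rs + ε := by
  have hrs := hdom.limit_pos
  have hlog : 0 < -Real.log κ := neg_pos.2 (Real.log_neg hb.kappa_pos hb.kappa_lt_one)
  -- The second entry makes `exp(-4εμ / c₀) ≥ κ ^ μ` for every `μ ≥ 0`, for any prescribed `κ < 1`.
  set ε := min (rs / 2) (c₀ * -Real.log κ / 4) with hε
  have hεpos : 0 < ε := by positivity
  have ev : ∀ᶠ φ in atTop, c₀ / rs ≤ m φ ∧ rs - ε < r₁ φ ∧ r₂ φ < rs + ε :=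
    (hb.tendsto.eventually_ge_atTop _).and
      ((hdom.tendsto_left.eventually_const_lt (by linarith)).and
        (hdom.tendsto_right.eventually_lt_const (by linarith)))
  obtain ⟨T, hT⟩ := eventually_atTop.1 ev
  refine ⟨ε, max T Θbar, le_max_right _ _, min_le_left _ _, ?_, fun φ hφ => ?_, fun φ hφ => ?_,
    fun φ hφ => ?_⟩
  · rw [div_le_iff₀ hc₀]
    linarith [min_le_right (rs / 2) (c₀ * -Real.log κ / 4)]
  · exact (div_le_iff₀ hrs).1 (hT φ ((le_max_left _ _).trans hφ)).1
  · exact (hT φ ((le_max_left _ _).trans hφ)).2.1.le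
  · exact (hT φ ((le_max_left _ _).trans hφ)).2.2.le

/-- The dichotomy for a nonnegative function whose bounds on cross-sections propagate. -/
theorem IsSpiral.sectionMax_decays_or_grows (hdom : IsSpiral θ₀ rs r₁ r₂)
    (hb : DriftBound θ₀ r₁ r₂ b Θbar κ m) {h T : ℝ} (hh : 0 < h) (hT : Θbar ≤ T)
    {w : Plane → ℝ} (hw : ContinuousOn w (UTilde θ₀ r₁ r₂)) (hw0 : ∀ x, 0 ≤ w x)
    (hmax : ∀ s θ t N, θ₀ ≤ s → s ≤ θ → θ ≤ t → 0 ≤ N → (∀ x ∈ crossSection r₁ r₂ s, w x ≤ N) →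
      (∀ x ∈ crossSection r₁ r₂ t, w x ≤ N) → ∀ x ∈ crossSection r₁ r₂ θ, w x ≤ N)
    (hgrowth : ∀ θ N, T ≤ θ - h → 0 ≤ N → (∀ x ∈ crossSection r₁ r₂ (θ - h), w x ≤ N) →
      (∀ x ∈ crossSection r₁ r₂ (θ + h), w x ≤ N) →
      ∀ x ∈ crossSection r₁ r₂ θ, w x ≤ (1 - κ ^ m (θ + h) / 2) * N) :
    Decays θ₀ (T + h + 2 * h) (1 / (2 * h)) κ m (sectionMax r₁ r₂ w) ∨
      Grows Θbar (1 / (2 * h)) κ m (sectionMax r₁ r₂ w) := by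
  have h0 := hb.le_start
  have hM : ∀ θ, θ₀ ≤ θ → 0 ≤ sectionMax r₁ r₂ w θ := fun θ hθ => by
    obtain ⟨x, hx⟩ := hdom.crossSection_nonempty hθ
    exact (hw0 x).trans (hdom.le_sectionMax hw hθ hx)
  refine decays_or_grows hb.monotone hb.kappa_pos hb.kappa_lt_one hb.divergent h0 hh
    (by linarith) hM ?_ ?_
  · intro s θ t hs hsθ hθt
    exact hdom.sectionMax_le (hs.trans hsθ) (hmax s θ t _ hs hsθ hθt (le_max_of_le_left (hM s hs))
      (fun x hx => (hdom.le_sectionMax hw hs hx).trans (le_max_left _ _))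
      (fun x hx => (hdom.le_sectionMax hw (hs.trans (hsθ.trans hθt)) hx).trans (le_max_right _ _)))
  · intro θ hθ
    have h1 : θ₀ ≤ θ - h := by linarith
    exact hdom.sectionMax_le (by linarith) (hgrowth θ _ (by linarith)
      (le_max_of_le_left (hM _ h1))
      (fun x hx => (hdom.le_sectionMax hw h1 hx).trans (le_max_left _ _))
      (fun x hx => (hdom.le_sectionMax hw (by linarith) hx).trans (le_max_right _ _)))

end MaximumPrinciple

end WindingDomain

/-! ### The dichotomy for subsolutions and solutions -/

theorem theorem4p5
    (θ₀ rs : ℝ) (r₁ r₂ : ℝ → ℝ) (hdom : WindingDomain.IsSpiral θ₀ rs r₁ r₂)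
    (A : WindingDomain.Plane → Matrix (Fin 2) (Fin 2) ℝ)
    (b : WindingDomain.Plane → WindingDomain.Plane)
    (hA : WindingDomain.UniformlyElliptic A (WindingDomain.U θ₀ r₁ r₂))
    (Θbar κ : ℝ) (m : ℝ → ℝ) (hb : WindingDomain.DriftBound θ₀ r₁ r₂ b Θbar κ m) :
    ∃ Θ₀ ν : ℝ, Θbar ≤ Θ₀ ∧ 0 < ν ∧
      -- the dichotomy for sub-solutions, which the two numbers serve as well
      (∀ u : WindingDomain.Plane → ℝ, WindingDomain.Admissible θ₀ r₁ r₂ u →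
        (∀ x ∈ WindingDomain.U θ₀ r₁ r₂, WindingDomain.ellipticOp A b u x ≤ 0) →
        (∀ x ∈ WindingDomain.lateral θ₀ r₁ r₂, u x ≤ 0) →
        WindingDomain.Decays θ₀ Θ₀ ν κ m
            (WindingDomain.sectionMax r₁ r₂ (fun x => max 0 (u x))) ∨
          WindingDomain.Grows Θbar ν κ m
            (WindingDomain.sectionMax r₁ r₂ (fun x => max 0 (u x)))) ∧
      -- the dichotomy for solutions
      (∀ u : WindingDomain.Plane → ℝ, WindingDomain.Admissible θ₀ r₁ r₂ u →
        (∀ x ∈ WindingDomain.U θ₀ r₁ r₂, WindingDomain.ellipticOp A b u x = 0) →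
        (∀ x ∈ WindingDomain.lateral θ₀ r₁ r₂, u x = 0) →
        WindingDomain.Decays θ₀ Θ₀ ν κ m
            (WindingDomain.sectionMax r₁ r₂ (fun x => |u x|)) ∨
          WindingDomain.Grows Θbar ν κ m
            (WindingDomain.sectionMax r₁ r₂ (fun x => |u x|))) := by
  obtain ⟨hsymm, ⟨c₀, hc₀, hell⟩, -⟩ := hA
  obtain ⟨ε, T, hT, hε, hεκ, hm, hr₁, hr₂⟩ := hdom.exists_thin hc₀ hb
  have hpi : 0 < Real.pi / 2 := by positivity
  have hg : ∀ N θ, 0 ≤ N → T ≤ θ - Real.pi / 2 →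
      0 ≤ (1 - κ ^ m (θ + Real.pi / 2) / 2) * N := by
    intro N θ hN hθ
    have : κ ^ m (θ + Real.pi / 2) ≤ 1 := Real.rpow_le_one hb.kappa_pos.le hb.kappa_lt_one.le
      (hb.nonneg _ (by linarith))
    exact mul_nonneg (by linarith) hN
  -- The step is `h = π / 2`, hence `ν = 1 / π`. `T` is fixed before `u`, so both numbers are
  -- independent of `u`.
  refine ⟨T + Real.pi / 2 + 2 * (Real.pi / 2), 1 / (2 * (Real.pi / 2)), by linarith,
    by positivity, fun u hu hL hγ => ?_, fun u hu hL hγ => ?_⟩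
  · refine hdom.sectionMax_decays_or_grows hb hpi hT (continuousOn_const.sup hu.2)
      (fun x => le_max_left _ _) ?_ ?_
    · intro s θ t N hs hsθ hθt hN h1 h2 x hx
      exact max_le hN (hdom.le_of_le_ends hsymm hc₀ hell hb hu hL hγ hs hsθ hθt hN
        (fun y hy => (max_le_iff.1 (h1 y hy)).2) (fun y hy => (max_le_iff.1 (h2 y hy)).2) x hx)
    · intro θ N hθ hN h1 h2 x hx
      exact max_le (hg N θ hN hθ) (hdom.le_mul_of_le_ends hsymm hc₀ hell hb hu hL hγ
        (hT.trans hθ) hε hεκ (hm _ (by linarith)) (fun φ hφ => hr₁ φ (hθ.trans hφ))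
        (fun φ hφ => hr₂ φ (hθ.trans hφ)) hN
        (fun y hy => (max_le_iff.1 (h1 y hy)).2) (fun y hy => (max_le_iff.1 (h2 y hy)).2) x hx)
  -- Both `u` and `-u` are subsolutions and obey the same bounds by levels `N`, hence so does `|u|`.
  · have hu' : WindingDomain.Admissible θ₀ r₁ r₂ (-u) := ⟨hu.1.neg, hu.2.neg⟩
    have hL₁ : ∀ x ∈ WindingDomain.U θ₀ r₁ r₂, WindingDomain.ellipticOp A b u x ≤ 0 :=
      fun x hx => (hL x hx).le
    have hL₂ : ∀ x ∈ WindingDomain.U θ₀ r₁ r₂, WindingDomain.ellipticOp A b (-u) x ≤ 0 :=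
      fun x hx => by rw [WindingDomain.ellipticOp_neg, hL x hx, neg_zero]
    have hγ₁ : ∀ x ∈ WindingDomain.lateral θ₀ r₁ r₂, u x ≤ 0 := fun x hx => (hγ x hx).le
    have hγ₂ : ∀ x ∈ WindingDomain.lateral θ₀ r₁ r₂, (-u) x ≤ 0 :=
      fun x hx => by simp [hγ x hx]
    refine hdom.sectionMax_decays_or_grows hb hpi hT hu.2.abs (fun x => abs_nonneg _) ?_ ?_
    · intro s θ t N hs hsθ hθt hN h1 h2 x hx
      exact abs_le'.2 ⟨hdom.le_of_le_ends hsymm hc₀ hell hb hu hL₁ hγ₁ hs hsθ hθt hN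
        (fun y hy => (abs_le'.1 (h1 y hy)).1) (fun y hy => (abs_le'.1 (h2 y hy)).1) x hx,
        hdom.le_of_le_ends hsymm hc₀ hell hb hu' hL₂ hγ₂ hs hsθ hθt hN
        (fun y hy => (abs_le'.1 (h1 y hy)).2) (fun y hy => (abs_le'.1 (h2 y hy)).2) x hx⟩
    · intro θ N hθ hN h1 h2 x hx
      exact abs_le'.2 ⟨hdom.le_mul_of_le_ends hsymm hc₀ hell hb hu hL₁ hγ₁
        (hT.trans hθ) hε hεκ (hm _ (by linarith)) (fun φ hφ => hr₁ φ (hθ.trans hφ))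
        (fun φ hφ => hr₂ φ (hθ.trans hφ)) hN
        (fun y hy => (abs_le'.1 (h1 y hy)).1) (fun y hy => (abs_le'.1 (h2 y hy)).1) x hx,
        hdom.le_mul_of_le_ends hsymm hc₀ hell hb hu' hL₂ hγ₂
        (hT.trans hθ) hε hεκ (hm _ (by linarith)) (fun φ hφ => hr₁ φ (hθ.trans hφ))
        (fun φ hφ => hr₂ φ (hθ.trans hφ)) hN
        (fun y hy => (abs_le'.1 (h1 y hy)).2) (fun y hy => (abs_le'.1 (h2 y hy)).2) x hx⟩
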